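/- Let $\mathbb{B}^n$ denote the open unit ball in $\mathbb{C}^n$ and let $\mathrm{Aut}(\mathbb{B}^n)$ be its group of holomorphic automorphisms, with the topology of uniform convergence on compact subsets. For a holomorphic map $f:\mathbb{B}^n\to\mathbb{B}^N$ put $$A_f=\{(\gamma,\psi)\in \mathrm{Aut}(\mathbb{B}^n)\times\mathrm{Aut}(\mathbb{B}^N): f\circ\gamma=\psi\circ f\},$$ and let $\Gamma_f\subseteq\mathrm{Aut}(\mathbb{B}^n)$ and $T_f\subseteq\mathrm{Aut}(\mathbb{B}^N)$ be the projections of $A_f$ onto the first and second factors. Call $f$ minimal if its image lies in no proper complex affine subspace of $\mathbb{C}^N$. Call $f$ completely non-rational if, for each positive-dimensional complex affine subspace $V$ of $\mathbb{C}^n$ that meets $\mathbb{B}^n$, the restriction of $f$ to $V\cap\mathbb{B}^n$ is not rational; here rational means that there are polynomials $p_1,\dots,p_N,q$ with $q$ not identically zero on $V$ and $q f_j=p_j$ on $V\cap\mathbb{B}^n$ for every $j$. **Theorem 5.1.** Let $f:\mathbb{B}^n\to\mathbb{B}^N$ be a minimal, completely non-rational, proper holomorphic map. Then either $\Gamma_f$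 and $T_f$ are both finite, or $\Gamma_f$ and $T_f$ are both noncompact. -/

import Mathlib

namespace BallMaps

/-- Complex Euclidean space `ℂⁿ` with its Hermitian norm. -/
abbrev CSpace (n : ℕ) : Type := EuclideanSpace ℂ (Fin n)

/-- The open unit ball `𝔹ⁿ` of `ℂⁿ`, with the subspace topology. -/
abbrev UnitBall (n : ℕ) : Type := ↥(Metric.ball (0 : CSpace n) 1)

/-- A map between unit balls is holomorphic if it is given by a function that is complex
differentiable on the (open) unit ball; the values of `F` off the ball play no role. -/
def IsHolomorphic {n N : ℕ} (f : UnitBall n → UnitBall N) : Prop :=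
  ∃ F : CSpace n → CSpace N,
    DifferentiableOn ℂ F (Metric.ball 0 1) ∧ ∀ z : UnitBall n, F z = f z

theorem IsHolomorphic.continuous {n N : ℕ} {f : UnitBall n → UnitBall N}
    (hf : IsHolomorphic f) : Continuous f := by
  obtain ⟨F, hF, hFf⟩ := hf
  refine continuous_induced_rng.2 ?_
  have h := continuousOn_iff_continuous_domRestrict.1 hF.continuousOn
  convert h using 1
  funext z
  exact (hFf z).symm

theorem isHolomorphic_id {n : ℕ} : IsHolomorphic (id : UnitBall n → UnitBall n) :=
  ⟨id, differentiableOn_id, fun _ => rfl⟩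

theorem IsHolomorphic.comp {n m k : ℕ} {g : UnitBall m → UnitBall k}
    {f : UnitBall n → UnitBall m} (hg : IsHolomorphic g) (hf : IsHolomorphic f) :
    IsHolomorphic (g ∘ f) := by
  obtain ⟨F, hF, hFf⟩ := hf
  obtain ⟨G, hG, hGg⟩ := hg
  refine ⟨G ∘ F, hG.comp hF ?_, fun z => ?_⟩
  · intro z hz
    have h := hFf ⟨z, hz⟩
    simp only at h
    rw [h]
    exact (f ⟨z, hz⟩).2
  · simp only [Function.comp_apply]
    rw [hFf z, hGg (f z)]

/-- The biholomorphic self-maps of the unit ball, as a subgroup (under composition) of the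
group of all bijections of the ball. -/
def autSubgroup (n : ℕ) : Subgroup (Equiv.Perm (UnitBall n)) where
  carrier := {γ | IsHolomorphic γ ∧ IsHolomorphic γ.symm}
  mul_mem' := by
    rintro γ δ ⟨h1, h2⟩ ⟨h3, h4⟩
    exact ⟨h1.comp h3, h4.comp h2⟩
  one_mem' := ⟨isHolomorphic_id, isHolomorphic_id⟩
  inv_mem' := by
    rintro γ ⟨h1, h2⟩
    exact ⟨h2, h1⟩

/-- The group `Aut(𝔹ⁿ)` of holomorphic automorphisms of the unit ball. -/
def BallAut (n : ℕ) : Type := ↥(autSubgroup n)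

noncomputable instance (n : ℕ) : Group (BallAut n) := inferInstanceAs (Group ↥(autSubgroup n))

instance (n : ℕ) : CoeFun (BallAut n) (fun _ => UnitBall n → UnitBall n) :=
  ⟨fun γ => γ.1⟩

/-- An automorphism of the ball as a continuous self-map of the ball. -/
noncomputable def BallAut.toContinuousMap {n : ℕ} (γ : BallAut n) : C(UnitBall n, UnitBall n) :=
  ⟨γ, γ.2.1.continuous⟩

/-- `Aut(𝔹ⁿ)` carries the compact-open topology (uniform convergence on compact subsets of the
ball), which is its Lie group topology. -/
noncomputable instance (n : ℕ) : TopologicalSpace (BallAut n) :=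
  TopologicalSpace.induced BallAut.toContinuousMap inferInstance

/-- `A_f`: the subgroup of `Aut(𝔹ⁿ) × Aut(𝔹ᴺ)` of the pairs `(γ, ψ)` with `f ∘ γ = ψ ∘ f`. -/
noncomputable def equivariancePairs {n N : ℕ} (f : UnitBall n → UnitBall N) :
    Subgroup (BallAut n × BallAut N) where
  carrier := {p | f ∘ (p.1 : UnitBall n → UnitBall n) = (p.2 : UnitBall N → UnitBall N) ∘ f}
  mul_mem' := by
    intro p q hp hq
    funext z
    have h1 : f (p.1 (q.1 z)) = p.2 (f (q.1 z)) := congrFun hp (q.1 z)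
    have h2 : f (q.1 z) = q.2 (f z) := congrFun hq z
    change f (p.1 (q.1 z)) = p.2 (q.2 (f z))
    rw [h1, h2]
  one_mem' := rfl
  inv_mem' := by
    intro p hp
    funext z
    change f (p.1.1.symm z) = p.2.1.symm (f z)
    have h1 : f (p.1.1 (p.1.1.symm z)) = p.2.1 (f (p.1.1.symm z)) := congrFun hp _
    rw [Equiv.apply_symm_apply] at h1
    rw [h1, Equiv.symm_apply_apply]

/-- `Γ_f`: the projection of `A_f` to `Aut(𝔹ⁿ)`. -/
noncomputable def sourceGroup {n N : ℕ} (f : UnitBall n → UnitBall N) : Subgroup (BallAut n) :=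
  (equivariancePairs f).map (MonoidHom.fst (BallAut n) (BallAut N))

/-- `T_f`: the projection of `A_f` to `Aut(𝔹ᴺ)`. -/
noncomputable def targetGroup {n N : ℕ} (f : UnitBall n → UnitBall N) : Subgroup (BallAut N) :=
  (equivariancePairs f).map (MonoidHom.snd (BallAut n) (BallAut N))

/-- `f` is minimal: its image lies in no lower-dimensional (that is, proper) complex affine
subspace of `ℂᴺ`. -/
def IsMinimal {n N : ℕ} (f : UnitBall n → UnitBall N) : Prop :=
  ∀ A : AffineSubspace ℂ (CSpace N), (∀ z, (f z : CSpace N) ∈ A) → A = ⊤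

/-- The restriction of `f` to the affine subspace `V` is rational: on `V ∩ 𝔹ⁿ` each component
of `f` is a quotient of polynomials, with a common denominator `q` that does not vanish
identically on `V`. (Polynomial functions on `V` are the restrictions of polynomials on `ℂⁿ`.) -/
def IsRationalOn {n N : ℕ} (f : UnitBall n → UnitBall N) (V : AffineSubspace ℂ (CSpace n)) :
    Prop :=
  ∃ (p : Fin N → MvPolynomial (Fin n) ℂ) (q : MvPolynomial (Fin n) ℂ),
    (∃ z ∈ V, MvPolynomial.eval (fun i => z i) q ≠ 0) ∧
    ∀ z : UnitBall n, (z : CSpace n) ∈ V → ∀ j : Fin N,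
      MvPolynomial.eval (fun i => (z : CSpace n) i) q * (f z : CSpace N) j =
        MvPolynomial.eval (fun i => (z : CSpace n) i) (p j)

/-- `f` is completely non-rational: its restriction to each positive-dimensional complex affine
subspace that meets the ball (so that there is something to restrict to) is not rational. -/
def IsCompletelyNonRational {n N : ℕ} (f : UnitBall n → UnitBall N) : Prop :=
  ∀ V : AffineSubspace ℂ (CSpace n), 0 < Module.finrank ℂ V.direction →
    (∃ z : UnitBall n, (z : CSpace n) ∈ V) → ¬ IsRationalOn f V

end BallMaps

/-! It suffices to treat the group `A_f` of pairs. If `A_f` is finite, so are its projections. If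
either projection is compact, `A_f` will be shown to be finite.

Compactness passes between the two sides: `f` carries the `Γ_f`-orbit of 0 onto the `T_f`-orbit of
`f 0`, so a compact set containing one orbit yields one for the other, by taking the image under the
continuous `f` or the preimage under the proper `f`. Automorphisms are isometries of the complex
hyperbolic metric, so each group, having a relatively compact orbit, fixes the point whose largest
distance to the orbit is least (`exists_fixedPoint`).

Let `a` and `b` be the fixed points. Conjugating by Möbius involutions that move them to the centres
turns every pair in `A_f` into a pair of linear isometries (Cartan) and `f` into a map `φ`
equivariant under these pairs. If there are infinitely many, some accumulate at the identity, and a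
limit of rescaled differences gives linear maps `(X, W) ≠ 0` with `X` skew-adjoint and `dφ(z)(X z) =
W (φ z)` (`exists_infinitesimal_symmetry`).

If `X = 0`, then `W` kills the image of `φ`, which minimality of `f` forbids. Otherwise `X e = l e`
for a unit vector `e` and some `l ≠ 0`, and `g(t) = φ(t e)` satisfies `l t g' = W g`. Comparing
Taylor coefficients, `g` is a polynomial. Undoing the Möbius changes makes `f` rational on a line
through `a`, contrary to complete non-rationality. -/

namespace BallMaps

open Metric Set

/-! ### Möbius involutions and the complex hyperbolic distance. -/

section Scale

variable {E : Type*} [NormedAddCommGroup E]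

/-- The factor `√(1 - ‖a‖²)` of the Möbius involution exchanging `0` and `a`. -/
noncomputable def moebiusScale (a : E) : ℝ := √(1 - ‖a‖ ^ 2)

theorem moebiusScale_pos {a : E} (ha : ‖a‖ < 1) : 0 < moebiusScale a :=
  Real.sqrt_pos.2 (by nlinarith [norm_nonneg a])

theorem moebiusScale_sq {a : E} (ha : ‖a‖ < 1) : moebiusScale a ^ 2 = 1 - ‖a‖ ^ 2 :=
  Real.sq_sqrt (by nlinarith [norm_nonneg a])

theorem moebiusScale_ne_zero {a : E} (ha : ‖a‖ < 1) : (moebiusScale a : ℂ) ≠ 0 :=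
  Complex.ofReal_ne_zero.2 (moebiusScale_pos ha).ne'

theorem one_add_moebiusScale_ne_zero (a : E) : (1 + (moebiusScale a : ℂ)) ≠ 0 := by
  have h : (0 : ℝ) < 1 + moebiusScale a := by
    have := Real.sqrt_nonneg (1 - ‖a‖ ^ 2)
    unfold moebiusScale
    linarith
  exact_mod_cast h.ne'

theorem one_sub_norm_sq_pos {z : E} (hz : ‖z‖ < 1) : 0 < 1 - ‖z‖ ^ 2 := by
  nlinarith [norm_nonneg z]

end Scale

section Moebius

variable {E : Type*} [NormedAddCommGroup E] [InnerProductSpace ℂ E]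

/-- The linear part `z ↦ s z + ⟪a, z⟫ / (1 + s) a` of the Möbius involution. -/
noncomputable def moebiusLin (a : E) : E →L[ℂ] E :=
  (moebiusScale a : ℂ) • ContinuousLinearMap.id ℂ E +
    (1 + (moebiusScale a : ℂ))⁻¹ • (innerSL ℂ a).smulRight a

/-- The Möbius involution of the unit ball exchanging `0` and `a`. -/
noncomputable def moebius (a z : E) : E := (1 - inner ℂ a z)⁻¹ • (a - moebiusLin a z)

theorem inner_self_eq_one_sub {a : E} (ha : ‖a‖ < 1) :
    inner ℂ a a = 1 - (moebiusScale a : ℂ) ^ 2 := by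
  rw [inner_self_eq_norm_sq_to_K]
  have h : ‖a‖ ^ 2 = 1 - moebiusScale a ^ 2 := by linarith [moebiusScale_sq ha]
  have h' : ((‖a‖ : ℝ) : ℂ) ^ 2 = 1 - (moebiusScale a : ℂ) ^ 2 := by exact_mod_cast h
  exact h'

theorem moebiusLin_apply (a z : E) :
    moebiusLin a z = (moebiusScale a : ℂ) • z +
      ((1 + (moebiusScale a : ℂ))⁻¹ * inner ℂ a z) • a := by
  simp [moebiusLin, smul_smul]

theorem inner_moebiusLin {a : E} (ha : ‖a‖ < 1) (z : E) :
    inner ℂ a (moebiusLin a z) = inner ℂ a z := by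
  have := one_add_moebiusScale_ne_zero a
  rw [moebiusLin_apply, inner_add_right, inner_smul_right, inner_smul_right,
    inner_self_eq_one_sub ha]
  field_simp
  ring

theorem moebiusLin_self {a : E} (ha : ‖a‖ < 1) : moebiusLin a a = a := by
  have := one_add_moebiusScale_ne_zero a
  rw [moebiusLin_apply, ← add_smul, inner_self_eq_one_sub ha]
  convert one_smul ℂ a
  field_simp
  ring

/-- The operator is the identity on the line of `a` and the scalar `s` on its orthogonal complement,
where `s ^ 2 + ‖a‖ ^ 2 = 1`. -/
theorem moebiusLin_moebiusLin {a : E} (ha : ‖a‖ < 1) (z : E) :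
    moebiusLin a (moebiusLin a z) = (moebiusScale a : ℂ) ^ 2 • z + inner ℂ a z • a := by
  have := one_add_moebiusScale_ne_zero a
  rw [moebiusLin_apply a (moebiusLin a z), inner_moebiusLin ha, moebiusLin_apply, smul_add,
    smul_smul, smul_smul, add_assoc, ← add_smul, ← sq]
  congr 2
  field_simp
  ring

theorem inner_moebiusLin_left (a w z : E) :
    inner ℂ (moebiusLin a w) z = inner ℂ w (moebiusLin a z) := by
  rw [moebiusLin_apply, moebiusLin_apply, inner_add_left, inner_add_right, inner_smul_left,
    inner_smul_left, inner_smul_right, inner_smul_right]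
  simp only [map_mul, map_inv₀, map_add, map_one, Complex.conj_ofReal, inner_conj_symm]
  ring

theorem moebiusLin_surjective {a : E} (ha : ‖a‖ < 1) : Function.Surjective (moebiusLin a) := by
  intro z
  have hs := moebiusScale_ne_zero ha
  refine ⟨((moebiusScale a : ℂ) ^ 2)⁻¹ • (moebiusLin a z - inner ℂ a z • a), ?_⟩
  rw [map_smul, map_sub, moebiusLin_moebiusLin ha, map_smul, moebiusLin_self ha,
    add_sub_cancel_right, smul_smul, inv_mul_cancel₀ (pow_ne_zero 2 hs), one_smul]

theorem one_sub_inner_ne_zero {w z : E} (hw : ‖w‖ < 1) (hz : ‖z‖ < 1) :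
    1 - inner ℂ w z ≠ 0 := by
  intro h
  have h1 : ‖(inner ℂ w z : ℂ)‖ ≤ ‖w‖ * ‖z‖ := norm_inner_le_norm w z
  rw [← sub_eq_zero.1 h, norm_one] at h1
  nlinarith [norm_nonneg w, norm_nonneg z]

/-- `1 - ⟪w, z⟫` is the indefinite Hermitian form on `ℂ ⊕ E` evaluated at the lifts `(1, w)` and
`(1, z)`; the involution preserves it up to one scalar factor for each point. The metric properties
of `moebius` all follow from this. -/
theorem one_sub_inner_moebius {a w z : E} (ha : ‖a‖ < 1) (hw : ‖w‖ < 1) (hz : ‖z‖ < 1) :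
    1 - inner ℂ (moebius a w) (moebius a z) =
      (moebiusScale a : ℂ) ^ 2 * (1 - inner ℂ w z) /
        ((1 - inner ℂ w a) * (1 - inner ℂ a z)) := by
  have h1 := one_sub_inner_ne_zero hw ha
  have h2 := one_sub_inner_ne_zero ha hz
  rw [moebius, moebius, inner_smul_left, inner_smul_right, inner_sub_left, inner_sub_right,
    inner_sub_right, inner_moebiusLin ha, inner_moebiusLin_left a w, inner_moebiusLin_left a w,
    moebiusLin_self ha, moebiusLin_moebiusLin ha, inner_add_right, inner_smul_right,
    inner_smul_right, inner_self_eq_one_sub ha]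
  simp only [map_inv₀, map_sub, map_one, inner_conj_symm]
  field_simp
  ring

theorem one_sub_norm_moebius_sq {a z : E} (ha : ‖a‖ < 1) (hz : ‖z‖ < 1) :
    1 - ‖moebius a z‖ ^ 2 =
      moebiusScale a ^ 2 * (1 - ‖z‖ ^ 2) / ‖1 - inner ℂ a z‖ ^ 2 := by
  have h := one_sub_inner_moebius ha hz hz
  have hc : (1 - inner ℂ z a) * (1 - inner ℂ a z) = ((‖1 - inner ℂ a z‖ ^ 2 : ℝ) : ℂ) := by
    rw [← inner_conj_symm z a, ← Complex.normSq_eq_norm_sq, Complex.normSq_eq_conj_mul_self]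
    simp
  rw [hc, inner_self_eq_norm_sq_to_K, inner_self_eq_norm_sq_to_K] at h
  simp only [Complex.coe_algebraMap] at h
  exact_mod_cast h

theorem norm_moebius_lt_one {a z : E} (ha : ‖a‖ < 1) (hz : ‖z‖ < 1) : ‖moebius a z‖ < 1 := by
  have hp : 0 < 1 - ‖moebius a z‖ ^ 2 := by
    rw [one_sub_norm_moebius_sq ha hz]
    have := moebiusScale_pos ha
    have := one_sub_norm_sq_pos hz
    have := norm_pos_iff.2 (one_sub_inner_ne_zero ha hz)
    positivity
  nlinarith [norm_nonneg (moebius a z)]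

theorem moebius_zero (a : E) : moebius a 0 = a := by simp [moebius]

theorem moebius_self {a : E} (ha : ‖a‖ < 1) : moebius a a = 0 := by
  simp [moebius, moebiusLin_self ha]

theorem moebius_moebius {a z : E} (ha : ‖a‖ < 1) (hz : ‖z‖ < 1) :
    moebius a (moebius a z) = z := by
  have hne := one_sub_inner_ne_zero ha hz
  have hs := moebiusScale_ne_zero ha
  have h1 : 1 - inner ℂ a (moebius a z) = (moebiusScale a : ℂ) ^ 2 / (1 - inner ℂ a z) := by
    rw [moebius, inner_smul_right, inner_sub_right, inner_moebiusLin ha,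
      inner_self_eq_one_sub ha]
    field_simp
    ring
  have h2 : a - moebiusLin a (moebius a z) =
      ((moebiusScale a : ℂ) ^ 2 / (1 - inner ℂ a z)) • z := by
    have h3 : moebiusLin a (moebius a z) = (1 - inner ℂ a z)⁻¹ •
        ((1 - inner ℂ a z) • a - (moebiusScale a : ℂ) ^ 2 • z) := by
      rw [moebius, map_smul, map_sub, moebiusLin_self ha, moebiusLin_moebiusLin ha, sub_smul,
        one_smul]
      congr 1
      abel
    rw [h3, smul_sub, smul_smul, inv_mul_cancel₀ hne, one_smul, sub_sub_cancel, smul_smul]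
    congr 1
    field_simp
  rw [moebius, h1, h2, smul_smul, inv_mul_cancel₀ (div_ne_zero (pow_ne_zero 2 hs) hne), one_smul]

theorem differentiableOn_moebius {a : E} (ha : ‖a‖ < 1) :
    DifferentiableOn ℂ (moebius a) (ball 0 1) := by
  have h1 : DifferentiableOn ℂ (fun z : E => (1 - inner ℂ a z)⁻¹) (ball 0 1) := by
    refine DifferentiableOn.inv ?_ fun z hz => one_sub_inner_ne_zero ha (by simpa using hz)
    exact ((innerSL ℂ a).differentiable.const_sub 1).differentiableOn
  exact h1.smul ((moebiusLin a).differentiable.const_sub a).differentiableOn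

/-- The square of the hyperbolic cosine of the Bergman distance of two points of the ball. -/
noncomputable def coshSq (z w : E) : ℝ :=
  ‖1 - inner ℂ w z‖ ^ 2 / ((1 - ‖z‖ ^ 2) * (1 - ‖w‖ ^ 2))

theorem norm_one_sub_inner_comm (w z : E) : ‖1 - inner ℂ w z‖ = ‖1 - inner ℂ z w‖ := by
  rw [← inner_conj_symm w z, ← Complex.norm_conj]
  simp

/-- `coshSq` is homogeneous of degree 0 in each lift, so the scalar factors cancel. -/
theorem coshSq_moebius {a w z : E} (ha : ‖a‖ < 1) (hw : ‖w‖ < 1) (hz : ‖z‖ < 1) :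
    coshSq (moebius a z) (moebius a w) = coshSq z w := by
  have h1 := norm_ne_zero_iff.2 (one_sub_inner_ne_zero ha hw)
  have h2 := norm_ne_zero_iff.2 (one_sub_inner_ne_zero ha hz)
  have h3 := (moebiusScale_pos ha).ne'
  have h4 := (one_sub_norm_sq_pos hz).ne'
  have h5 := (one_sub_norm_sq_pos hw).ne'
  rw [coshSq, coshSq, one_sub_norm_moebius_sq ha hz, one_sub_norm_moebius_sq ha hw,
    one_sub_inner_moebius ha hw hz, norm_div, norm_mul, norm_mul, norm_pow, Complex.norm_real,
    Real.norm_of_nonneg (moebiusScale_pos ha).le, norm_one_sub_inner_comm w a]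
  field_simp

theorem one_lt_coshSq {w z : E} (hw : ‖w‖ < 1) (hz : ‖z‖ < 1) (h : z ≠ w) :
    1 < coshSq z w := by
  rw [← coshSq_moebius hw hw hz, moebius_self hw]
  have h1 : moebius w z ≠ 0 := by
    intro h0
    apply h
    rw [← moebius_moebius hw hz, h0, moebius_zero]
  have h2 := norm_pos_iff.2 h1
  have h3 := one_sub_norm_sq_pos (norm_moebius_lt_one hw hz)
  simp only [coshSq, inner_zero_left, sub_zero, norm_one, one_pow, norm_zero, ne_eq,
    OfNat.ofNat_ne_zero, not_false_eq_true, zero_pow, mul_one]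
  rw [lt_div_iff₀ h3]
  nlinarith

/-- The midpoint inequality of complex hyperbolic space. -/
theorem exists_midpoint {z₁ z₂ : E} (h₁ : ‖z₁‖ < 1) (h₂ : ‖z₂‖ < 1) (hne : z₁ ≠ z₂) :
    ∃ m : E, ‖m‖ < 1 ∧ ∃ q : ℝ, 0 ≤ q ∧ q < 1 ∧ ∀ w : E, ‖w‖ < 1 →
      coshSq m w ≤ q * max (coshSq z₁ w) (coshSq z₂ w) := by
  have hp₁ := one_sub_norm_sq_pos h₁
  have hp₂ := one_sub_norm_sq_pos h₂
  set h : ℂ := 1 - inner ℂ z₂ z₁ with hh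
  have hh0 : h ≠ 0 := one_sub_inner_ne_zero h₂ h₁
  -- `t₁ (1, z₁)` and `t₂ (1, z₂)` are lifts of norm one for the form `|σ|² - ‖v‖²` on `ℂ ⊕ E`; `C`,
  -- the modulus of their product, is the hyperbolic cosine of the distance.
  set t₁ : ℝ := (√(1 - ‖z₁‖ ^ 2))⁻¹
  set t₂ : ℝ := (√(1 - ‖z₂‖ ^ 2))⁻¹
  have ht₁ : t₁ ^ 2 * (1 - ‖z₁‖ ^ 2) = 1 := by
    rw [inv_pow, Real.sq_sqrt hp₁.le, inv_mul_cancel₀ hp₁.ne']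
  have ht₂ : t₂ ^ 2 * (1 - ‖z₂‖ ^ 2) = 1 := by
    rw [inv_pow, Real.sq_sqrt hp₂.le, inv_mul_cancel₀ hp₂.ne']
  have ht₁p : 0 < t₁ := by positivity
  have ht₂p : 0 < t₂ := by positivity
  set C : ℝ := t₁ * t₂ * ‖h‖ with hC
  have hCsq : C ^ 2 = coshSq z₁ z₂ := by
    rw [coshSq, eq_div_iff (mul_pos hp₁ hp₂).ne', ← hh]
    calc C ^ 2 * ((1 - ‖z₁‖ ^ 2) * (1 - ‖z₂‖ ^ 2))
        = (t₁ ^ 2 * (1 - ‖z₁‖ ^ 2)) * (t₂ ^ 2 * (1 - ‖z₂‖ ^ 2)) * ‖h‖ ^ 2 := by rw [hC]; ring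
      _ = ‖h‖ ^ 2 := by rw [ht₁, ht₂]; ring
  have hC1 : 1 < C := by
    have := one_lt_coshSq h₂ h₁ hne
    rw [← hCsq] at this
    have hC0 : 0 ≤ C := by positivity
    nlinarith
  -- The phase `u` makes the product of the two lifts equal to the positive number `C`. The midpoint
  -- is the class of their sum `(σ, v)`, whose square norm is then `1 + 1 + 2 * C`.
  set u : ℂ := (starRingEnd ℂ) h / ‖h‖ with hu
  have hhn : (‖h‖ : ℂ) ≠ 0 := by exact_mod_cast norm_ne_zero_iff.2 hh0
  have huh : u * h = ‖h‖ := by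
    rw [hu, div_mul_eq_mul_div, ← Complex.normSq_eq_conj_mul_self, Complex.normSq_eq_norm_sq,
      Complex.ofReal_pow, sq, mul_div_assoc, div_self hhn, mul_one]
  have hun : ‖u‖ = 1 := by
    have := congrArg norm huh
    rw [norm_mul, Complex.norm_real, norm_norm] at this
    exact mul_right_cancel₀ (norm_ne_zero_iff.2 hh0) (by rw [this, one_mul])
  set α : ℂ := t₁ * u with hα
  set β : ℂ := (t₂ : ℂ) with hβ
  have hαn : ‖α‖ = t₁ := by
    rw [hα, norm_mul, hun, Complex.norm_real, Real.norm_of_nonneg ht₁p.le, mul_one]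
  have hβn : ‖β‖ = t₂ := by rw [hβ, Complex.norm_real, Real.norm_of_nonneg ht₂p.le]
  set σ : ℂ := α + β with hσ
  set v : E := α • z₁ + β • z₂ with hv
  have key : ‖σ‖ ^ 2 - ‖v‖ ^ 2 = 2 + 2 * C := by
    have e1 : ‖σ‖ ^ 2 = ‖α‖ ^ 2 + 2 * (α * (starRingEnd ℂ) β).re + ‖β‖ ^ 2 := by
      rw [hσ, ← Complex.normSq_eq_norm_sq, ← Complex.normSq_eq_norm_sq,
        ← Complex.normSq_eq_norm_sq, Complex.normSq_add]
      ring
    have e2 : ‖v‖ ^ 2 = ‖α‖ ^ 2 * ‖z₁‖ ^ 2 + 2 * (α * (starRingEnd ℂ) β * inner ℂ z₂ z₁).re +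
        ‖β‖ ^ 2 * ‖z₂‖ ^ 2 := by
      rw [hv, @norm_add_sq ℂ, norm_smul, norm_smul, mul_pow, mul_pow, inner_smul_left,
        inner_smul_right, ← inner_conj_symm z₁ z₂]
      congr 3
      simp only [RCLike.re_to_complex, Complex.mul_re, Complex.mul_im, Complex.conj_re,
        Complex.conj_im]
      ring
    have e3 : α * (starRingEnd ℂ) β * h = C := by
      calc α * (starRingEnd ℂ) β * h = t₁ * t₂ * (u * h) := by
            rw [hα, hβ, Complex.conj_ofReal]; ring
        _ = C := by rw [huh, hC]; push_cast; ring
    have e4 : (α * (starRingEnd ℂ) β).re - (α * (starRingEnd ℂ) β * inner ℂ z₂ z₁).re = C := by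
      rw [← Complex.sub_re, ← Complex.ofReal_re C, ← e3, hh]
      congr 1
      ring
    rw [e1, e2, hαn, hβn]
    linarith
  have hvσ : ‖v‖ < ‖σ‖ := by
    have : 0 < ‖σ‖ ^ 2 - ‖v‖ ^ 2 := by rw [key]; linarith
    nlinarith [norm_nonneg v, norm_nonneg σ]
  have hσp : 0 < ‖σ‖ := (norm_nonneg v).trans_lt hvσ
  have hσ0 : σ ≠ 0 := norm_pos_iff.1 hσp
  have hmn : ‖σ⁻¹ • v‖ = ‖v‖ / ‖σ‖ := by rw [norm_smul, norm_inv, div_eq_inv_mul]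
  refine ⟨σ⁻¹ • v, ?_, 2 / (1 + C), by positivity, ?_, ?_⟩
  · rw [hmn, div_lt_one hσp]
    exact hvσ
  · rw [div_lt_one (by linarith)]
    linarith
  intro w hw
  have hpw := one_sub_norm_sq_pos hw
  have f1 : σ * (1 - inner ℂ w (σ⁻¹ • v)) = α * (1 - inner ℂ w z₁) + β * (1 - inner ℂ w z₂) := by
    rw [inner_smul_right, mul_sub, mul_one, mul_inv_cancel_left₀ hσ0, hv, inner_add_right,
      inner_smul_right, inner_smul_right, hσ]
    ring
  set x := ‖1 - inner ℂ w z₁‖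
  set y := ‖1 - inner ℂ w z₂‖
  have f2 : ‖σ‖ * ‖1 - inner ℂ w (σ⁻¹ • v)‖ ≤ t₁ * x + t₂ * y := by
    rw [← norm_mul, f1]
    refine (norm_add_le _ _).trans ?_
    rw [norm_mul α, norm_mul β, hαn, hβn]
  have f3 : (‖σ‖ * ‖1 - inner ℂ w (σ⁻¹ • v)‖) ^ 2 ≤ 2 * (t₁ ^ 2 * x ^ 2) + 2 * (t₂ ^ 2 * y ^ 2) := by
    refine (pow_le_pow_left₀ (by positivity) f2 2).trans ?_
    nlinarith [sq_nonneg (t₁ * x - t₂ * y)]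
  have g1 : coshSq z₁ w = t₁ ^ 2 * x ^ 2 / (1 - ‖w‖ ^ 2) := by
    rw [coshSq, div_eq_div_iff (mul_pos hp₁ hpw).ne' hpw.ne']
    linear_combination (-(x ^ 2 * (1 - ‖w‖ ^ 2))) * ht₁
  have g2 : coshSq z₂ w = t₂ ^ 2 * y ^ 2 / (1 - ‖w‖ ^ 2) := by
    rw [coshSq, div_eq_div_iff (mul_pos hp₂ hpw).ne' hpw.ne']
    linear_combination (-(y ^ 2 * (1 - ‖w‖ ^ 2))) * ht₂
  have g3 : coshSq (σ⁻¹ • v) w =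
      (‖σ‖ * ‖1 - inner ℂ w (σ⁻¹ • v)‖) ^ 2 / ((2 + 2 * C) * (1 - ‖w‖ ^ 2)) := by
    have : 1 - ‖σ⁻¹ • v‖ ^ 2 = (2 + 2 * C) / ‖σ‖ ^ 2 := by
      rw [hmn, ← key]
      field_simp
    rw [coshSq, this]
    field_simp
  have hC' : 0 < 1 + C := by linarith
  calc coshSq (σ⁻¹ • v) w
      ≤ (2 * (t₁ ^ 2 * x ^ 2) + 2 * (t₂ ^ 2 * y ^ 2)) / ((2 + 2 * C) * (1 - ‖w‖ ^ 2)) := by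
        rw [g3]
        gcongr
    _ = (coshSq z₁ w + coshSq z₂ w) / (1 + C) := by
        rw [g1, g2]
        field_simp
    _ ≤ (2 * max (coshSq z₁ w) (coshSq z₂ w)) / (1 + C) := by
        gcongr
        linarith [le_max_left (coshSq z₁ w) (coshSq z₂ w),
          le_max_right (coshSq z₁ w) (coshSq z₂ w)]
    _ = _ := by ring

theorem coshSq_map (U : E →ₗᵢ[ℂ] E) (z w : E) : coshSq (U z) (U w) = coshSq z w := by
  simp [coshSq]

end Moebius

/-! ### Automorphisms fixing the centre. -/

section Cartan

variable {E : Type*} [NormedAddCommGroup E] [InnerProductSpace ℂ E]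

/-- Cartan: a holomorphic automorphism of the ball that fixes the centre is a linear isometry. -/
theorem exists_linearIsometry_eqOn_ball {F G : E → E}
    (hF : DifferentiableOn ℂ F (ball 0 1)) (hG : DifferentiableOn ℂ G (ball 0 1))
    (hFm : MapsTo F (ball 0 1) (ball 0 1)) (hGm : MapsTo G (ball 0 1) (ball 0 1))
    (hF0 : F 0 = 0) (hGF : ∀ z ∈ ball (0 : E) 1, G (F z) = z) :
    ∃ U : E →ₗᵢ[ℂ] E, ∀ z ∈ ball (0 : E) 1, F z = U z := by
  have hnhds : ball (0 : E) 1 ∈ nhds 0 := ball_mem_nhds 0 one_pos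
  have h0 : (0 : E) ∈ ball (0 : E) 1 := mem_ball_self one_pos
  have hG0 : G 0 = 0 := by simpa [hF0] using hGF 0 h0
  have hdF := (hF.differentiableAt hnhds)
  have hdG := (hG.differentiableAt hnhds)
  have hcomp : (fderiv ℂ G 0).comp (fderiv ℂ F 0) = ContinuousLinearMap.id ℂ E := by
    have h1 : HasFDerivAt (G ∘ F) ((fderiv ℂ G 0).comp (fderiv ℂ F 0)) 0 := by
      refine HasFDerivAt.comp 0 ?_ hdF.hasFDerivAt
      rw [hF0]
      exact hdG.hasFDerivAt
    have h2 : HasFDerivAt (G ∘ F) (ContinuousLinearMap.id ℂ E) 0 :=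
      (hasFDerivAt_id 0).congr_of_eventuallyEq (Filter.eventually_of_mem hnhds hGF)
    exact h1.unique h2
  -- The Schwarz lemma bounds both derivatives at 0 by 1; being inverse to each other on one side,
  -- they force `fderiv ℂ F 0` to preserve norms.
  have hnF : ‖fderiv ℂ F 0‖ ≤ 1 :=
    Complex.norm_fderiv_le_one_of_mapsTo_ball hF (by rw [hF0]; exact hFm.mono_right ball_subset_closedBall) one_pos
  have hnG : ‖fderiv ℂ G 0‖ ≤ 1 :=
    Complex.norm_fderiv_le_one_of_mapsTo_ball hG (by rw [hG0]; exact hGm.mono_right ball_subset_closedBall) one_pos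
  have hiso : ∀ x, ‖fderiv ℂ F 0 x‖ = ‖x‖ := by
    intro x
    refine le_antisymm ((fderiv ℂ F 0).le_of_opNorm_le hnF x |>.trans_eq (one_mul _)) ?_
    have := (fderiv ℂ G 0).le_of_opNorm_le hnG (fderiv ℂ F 0 x)
    rw [one_mul] at this
    rwa [← ContinuousLinearMap.comp_apply, hcomp, ContinuousLinearMap.id_apply] at this
  refine ⟨⟨(fderiv ℂ F 0 : E →ₗ[ℂ] E), hiso⟩, fun z hz => ?_⟩
  rcases eq_or_ne z 0 with rfl | hz0
  · simp [hF0]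
  have hzn : 0 < ‖z‖ := norm_pos_iff.2 hz0
  have hz1 : ‖z‖ < 1 := by simpa using hz
  set e : E := (‖z‖ : ℂ)⁻¹ • z with he
  have hen : ‖e‖ = 1 := by
    rw [he, norm_smul, norm_inv, Complex.norm_real, norm_norm, inv_mul_cancel₀ hzn.ne']
  have hze : z = (‖z‖ : ℂ) • e := by
    rw [he, smul_smul, mul_inv_cancel₀ (by exact_mod_cast hzn.ne'), one_smul]
  have hmap : MapsTo (fun t : ℂ => t • e) (ball 0 1) (ball 0 1) := by
    intro t ht
    simpa [norm_smul, hen] using ht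
  set g : ℂ → E := fun t => F (t • e) with hg
  have hgd : DifferentiableOn ℂ g (ball 0 1) :=
    hF.comp (differentiable_id.smul_const e).differentiableOn hmap
  have hg0 : g 0 = 0 := by simp [hg, hF0]
  have hgm : MapsTo g (ball 0 1) (closedBall (g 0) 1) := by
    rw [hg0]
    exact (hFm.comp hmap).mono_right ball_subset_closedBall
  have hderiv : dslope g 0 0 = fderiv ℂ F 0 e := by
    rw [dslope_same]
    have h1 : HasDerivAt (fun t : ℂ => t • e) e 0 := by
      simpa using (hasDerivAt_id (0 : ℂ)).smul_const e
    have h2 : HasFDerivAt F (fderiv ℂ F 0) ((0 : ℂ) • e) := by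
      rw [zero_smul]
      exact hdF.hasFDerivAt
    exact (h2.comp_hasDerivAt (0 : ℂ) h1).deriv
  -- On the disc through `z` the Schwarz bound is attained at 0. In a strictly convex target,
  -- equality forces the slice to be affine.
  have : StrictConvexSpace ℝ E := by
    let := InnerProductSpace.rclikeToReal ℂ E
    infer_instance
  have h := Complex.affine_of_mapsTo_ball_of_norm_dslope_eq_div hgd hgm
    (mem_ball_self one_pos) (by rw [hderiv, hiso, hen, div_one])
    (show (‖z‖ : ℂ) ∈ ball (0 : ℂ) 1 by simpa using hz1)
  simp only [hg0, sub_zero, zero_add, hderiv, ← map_smul, ← hze] at h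
  rw [hg] at h
  simp only [← hze] at h
  exact h

end Cartan

end BallMaps

namespace BallMaps

open Metric Set

/-! ### Automorphisms as isometries, and the fixed point theorem. -/

section Automorphisms

variable {n : ℕ}

theorem UnitBall.norm_lt_one (z : UnitBall n) : ‖(z : CSpace n)‖ < 1 := mem_ball_zero_iff.1 z.2

/-- The centre of the ball. -/
def centre (n : ℕ) : UnitBall n := ⟨0, mem_ball_self one_pos⟩

theorem coe_centre : (centre n : CSpace n) = 0 := rfl

/-- The Möbius involution as a self-map of the ball. -/
noncomputable def ballMoebius (a z : UnitBall n) : UnitBall n :=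
  ⟨moebius (a : CSpace n) z, mem_ball_zero_iff.2 (norm_moebius_lt_one a.norm_lt_one z.norm_lt_one)⟩

theorem coe_ballMoebius (a z : UnitBall n) :
    (ballMoebius a z : CSpace n) = moebius (a : CSpace n) z := rfl

theorem ballMoebius_ballMoebius (a z : UnitBall n) : ballMoebius a (ballMoebius a z) = z :=
  Subtype.ext (moebius_moebius a.norm_lt_one z.norm_lt_one)

theorem ballMoebius_self (a : UnitBall n) : ballMoebius a a = centre n :=
  Subtype.ext (moebius_self a.norm_lt_one)

theorem ballMoebius_centre (a : UnitBall n) : ballMoebius a (centre n) = a :=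
  Subtype.ext (moebius_zero (a : CSpace n))

theorem isHolomorphic_ballMoebius (a : UnitBall n) : IsHolomorphic (ballMoebius a) :=
  ⟨moebius (a : CSpace n), differentiableOn_moebius a.norm_lt_one, fun _ => rfl⟩

/-- The Möbius involution as an automorphism of the ball. -/
noncomputable def moebiusAut (a : UnitBall n) : BallAut n :=
  show ↥(autSubgroup n) from
    ⟨⟨ballMoebius a, ballMoebius a, ballMoebius_ballMoebius a, ballMoebius_ballMoebius a⟩,
      isHolomorphic_ballMoebius a, isHolomorphic_ballMoebius a⟩

theorem BallAut.mul_apply (γ δ : BallAut n) (z : UnitBall n) : (γ * δ) z = γ (δ z) := rfl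

theorem BallAut.ext {γ δ : BallAut n} (h : ∀ z, γ z = δ z) : γ = δ :=
  Subtype.ext (Equiv.ext h)

theorem BallAut.exists_linearIsometry {γ : BallAut n} (h : γ (centre n) = centre n) :
    ∃ U : CSpace n →ₗᵢ[ℂ] CSpace n, ∀ z : UnitBall n, (γ z : CSpace n) = U z := by
  obtain ⟨F, hF, hFγ⟩ := γ.2.1
  obtain ⟨G, hG, hGγ⟩ := γ.2.2
  have hFm : ∀ z (hz : z ∈ ball (0 : CSpace n) 1), F z = γ ⟨z, hz⟩ := fun z hz => hFγ ⟨z, hz⟩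
  have hGm : ∀ z (hz : z ∈ ball (0 : CSpace n) 1), G z = γ.1.symm ⟨z, hz⟩ :=
    fun z hz => hGγ ⟨z, hz⟩
  obtain ⟨U, hU⟩ := exists_linearIsometry_eqOn_ball hF hG
    (fun z hz => by rw [hFm z hz]; exact (γ ⟨z, hz⟩).2)
    (fun z hz => by rw [hGm z hz]; exact (γ.1.symm ⟨z, hz⟩).2)
    (by
      have := hFm 0 (mem_ball_self one_pos)
      rw [this]
      exact congrArg Subtype.val h)
    (fun z hz => by
      rw [hFm z hz, hGγ (γ ⟨z, hz⟩)]
      exact congrArg Subtype.val (γ.1.symm_apply_apply ⟨z, hz⟩))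
  exact ⟨U, fun z => by rw [← hFγ z, hU z z.2]⟩

/-- Following `γ` with the involution that returns `γ 0` to 0 gives a linear isometry; both it and
the involution preserve `coshSq`. -/
theorem BallAut.coshSq_apply (γ : BallAut n) (z w : UnitBall n) :
    coshSq (γ z : CSpace n) (γ w) = coshSq (z : CSpace n) w := by
  set c := γ (centre n)
  obtain ⟨U, hU⟩ := BallAut.exists_linearIsometry (γ := moebiusAut c * γ) (ballMoebius_self c)
  have h : ∀ x, (moebius (c : CSpace n) (γ x : CSpace n)) = U x := hU
  rw [← coshSq_moebius c.norm_lt_one (γ w).norm_lt_one (γ z).norm_lt_one, h, h, coshSq_map]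

theorem one_le_coshSq (z w : UnitBall n) : 1 ≤ coshSq (z : CSpace n) w := by
  rcases eq_or_ne (z : CSpace n) w with h | h
  · have hw := (one_sub_norm_sq_pos w.norm_lt_one)
    rw [h, coshSq, inner_self_eq_norm_sq_to_K]
    simp only [Complex.coe_algebraMap]
    have : (1 : ℂ) - (‖(w : CSpace n)‖ : ℂ) ^ 2 = ((1 - ‖(w : CSpace n)‖ ^ 2 : ℝ) : ℂ) := by
      push_cast; rfl
    rw [this, Complex.norm_real, Real.norm_of_nonneg hw.le, sq (1 - _), div_self (by positivity)]
  · exact (one_lt_coshSq w.norm_lt_one z.norm_lt_one h).le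

theorem continuous_coshSq (w : UnitBall n) :
    Continuous fun z : UnitBall n => coshSq (z : CSpace n) w := by
  have hw := (one_sub_norm_sq_pos w.norm_lt_one).ne'
  unfold coshSq
  refine Continuous.div (by fun_prop) (by fun_prop) fun z => ?_
  exact mul_ne_zero (one_sub_norm_sq_pos z.norm_lt_one).ne' hw

theorem coshSq_le {ρ : ℝ} (hρ : ρ < 1) (z w : UnitBall n) (hw : ‖(w : CSpace n)‖ ≤ ρ) :
    coshSq (z : CSpace n) w ≤ 4 / ((1 - ‖(z : CSpace n)‖ ^ 2) * (1 - ρ ^ 2)) := by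
  have hz := one_sub_norm_sq_pos z.norm_lt_one
  have hρ0 := (norm_nonneg _).trans hw
  have h1 : 0 < 1 - ρ ^ 2 := by nlinarith
  have h2 : ‖1 - inner ℂ (w : CSpace n) z‖ ≤ 2 := by
    refine (norm_sub_le _ _).trans ?_
    have := norm_inner_le_norm (𝕜 := ℂ) (w : CSpace n) z
    rw [norm_one]
    nlinarith [norm_nonneg (w : CSpace n), norm_nonneg (z : CSpace n), w.norm_lt_one,
      z.norm_lt_one]
  have h3 : ‖1 - inner ℂ (w : CSpace n) z‖ ^ 2 ≤ 4 := by nlinarith [norm_nonneg (1 - inner ℂ (w : CSpace n) z)]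
  have h4 : ‖(w : CSpace n)‖ ^ 2 ≤ ρ ^ 2 := by gcongr
  unfold coshSq
  gcongr

/-- The bound blows up as `z` tends to the sphere, uniformly in `w`; this confines the minimisation
in `exists_fixedPoint` to a compact ball. -/
theorem le_coshSq {ρ : ℝ} (hρ : ρ < 1) (z w : UnitBall n) (hw : ‖(w : CSpace n)‖ ≤ ρ) :
    (1 - ρ) ^ 2 / (1 - ‖(z : CSpace n)‖ ^ 2) ≤ coshSq (z : CSpace n) w := by
  have hz := one_sub_norm_sq_pos z.norm_lt_one
  have hw' := one_sub_norm_sq_pos w.norm_lt_one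
  have h1 : 1 - ρ ≤ ‖1 - inner ℂ (w : CSpace n) z‖ := by
    have h := norm_sub_norm_le (1 : ℂ) (inner ℂ (w : CSpace n) z)
    have := norm_inner_le_norm (𝕜 := ℂ) (w : CSpace n) z
    rw [norm_one] at h
    nlinarith [norm_nonneg (w : CSpace n), norm_nonneg (z : CSpace n), z.norm_lt_one]
  unfold coshSq
  rw [div_le_div_iff₀ hz (by positivity)]
  have h2 : (1 - ρ) ^ 2 ≤ ‖1 - inner ℂ (w : CSpace n) z‖ ^ 2 :=
    pow_le_pow_left₀ (by linarith) h1 2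
  have h3 : (1 - ‖(z : CSpace n)‖ ^ 2) * (1 - ‖(w : CSpace n)‖ ^ 2) ≤
      1 - ‖(z : CSpace n)‖ ^ 2 := by nlinarith [norm_nonneg (w : CSpace n)]
  exact mul_le_mul h2 h3 (by positivity) (by positivity)

theorem isCompact_setOf_norm_le {R : ℝ} (hR : R < 1) :
    IsCompact {z : UnitBall n | ‖(z : CSpace n)‖ ≤ R} := by
  rw [Subtype.isCompact_iff]
  have h : Subtype.val '' {z : UnitBall n | ‖(z : CSpace n)‖ ≤ R} = closedBall (0 : CSpace n) R := by
    ext z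
    refine ⟨?_, fun hz => ?_⟩
    · rintro ⟨y, hy, rfl⟩
      exact mem_closedBall_zero_iff.2 hy
    · have hz' := mem_closedBall_zero_iff.1 hz
      exact ⟨⟨z, mem_ball_zero_iff.2 (hz'.trans_lt hR)⟩, hz', rfl⟩
  rw [h]
  exact isCompact_closedBall 0 R

/-- A group of automorphisms of the ball with a relatively compact orbit has a fixed point. -/
theorem exists_fixedPoint (G : Subgroup (BallAut n)) (p : UnitBall n) {ρ : ℝ} (hρ : ρ < 1)
    (hG : ∀ g ∈ G, ‖(g p : CSpace n)‖ ≤ ρ) : ∃ a : UnitBall n, ∀ g ∈ G, g a = a := by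
  -- A monotone function of the radius of the orbit as seen from `z`. Its minimiser is the
  -- circumcentre of the orbit.
  let r : UnitBall n → ℝ := fun z => ⨆ g : G, coshSq (z : CSpace n) ((g : BallAut n) p)
  have hbdd : ∀ z : UnitBall n,
      BddAbove (range fun g : G => coshSq (z : CSpace n) ((g : BallAut n) p)) := by
    intro z
    refine ⟨4 / ((1 - ‖(z : CSpace n)‖ ^ 2) * (1 - ρ ^ 2)), ?_⟩
    rintro _ ⟨g, rfl⟩
    exact coshSq_le hρ z ((g : BallAut n) p) (hG g g.2)
  have hle : ∀ (z : UnitBall n) (g : G), coshSq (z : CSpace n) ((g : BallAut n) p) ≤ r z :=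
    fun z g => le_ciSup (hbdd z) g
  have hr1 : ∀ z, 1 ≤ r z := fun z => (one_le_coshSq z p).trans (hle z 1)
  have hlsc : LowerSemicontinuous r :=
    lowerSemicontinuous_ciSup hbdd fun g => (continuous_coshSq _).lowerSemicontinuous
  have hinv : ∀ g ∈ G, ∀ z, r (g z) ≤ r z := by
    intro g hg z
    refine ciSup_le fun h => ?_
    have h1 : (h : BallAut n) p = g ((g⁻¹ * h : BallAut n) p) := by
      rw [← BallAut.mul_apply, mul_inv_cancel_left]
    rw [h1, BallAut.coshSq_apply]
    exact hle z ⟨g⁻¹ * h, G.mul_mem (G.inv_mem hg) h.2⟩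
  have hM := (zero_lt_one.trans_le (hr1 (centre n)))
  set M := r (centre n)
  -- Chosen so that `‖z‖ > R` gives `(1 - ρ) ^ 2 / (1 - ‖z‖ ^ 2) ≥ M`, hence `r z ≥ M`: the minimum
  -- over the ball of radius `R` is global.
  set R : ℝ := √(1 - (1 - ρ) ^ 2 / M)
  have hc : 0 < (1 - ρ) ^ 2 / M := by
    have : 0 < 1 - ρ := by linarith
    positivity
  have hR : R < 1 := by
    rw [Real.sqrt_lt' one_pos]
    linarith
  have hcR : ‖(centre n : CSpace n)‖ ≤ R := by
    rw [coe_centre, norm_zero]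
    exact Real.sqrt_nonneg _
  obtain ⟨a, -, ha⟩ := (hlsc.lowerSemicontinuousOn
    {z : UnitBall n | ‖(z : CSpace n)‖ ≤ R}).exists_isMinOn
      ⟨centre n, hcR⟩ (isCompact_setOf_norm_le hR)
  have hmin : ∀ z, r a ≤ r z := by
    intro z
    by_cases hz : ‖(z : CSpace n)‖ ≤ R
    · exact ha hz
    · have h1 : r a ≤ M := ha hcR
      refine h1.trans ?_
      have hzp := one_sub_norm_sq_pos z.norm_lt_one
      have h2 := (le_coshSq hρ z _ (hG 1 G.one_mem)).trans (hle z 1)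
      refine le_trans ?_ h2
      rw [not_le, Real.sqrt_lt (sub_nonneg.2 ?_) (norm_nonneg _)] at hz
      · rw [le_div_iff₀ hzp]
        have : 1 - ‖(z : CSpace n)‖ ^ 2 ≤ (1 - ρ) ^ 2 / M := by linarith
        rwa [le_div_iff₀ hM, mul_comm] at this
      · have := (le_coshSq hρ (centre n) _ (hG 1 G.one_mem)).trans (hle (centre n) 1)
        rw [div_le_one hM]
        simpa [coe_centre] using this
  refine ⟨a, fun g hg => ?_⟩
  by_contra hne
  -- If `g a ≠ a`, both points have radius at most `r a`, so their midpoint has radius at most `q *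
  -- r a < r a`, contradicting minimality.
  obtain ⟨m, hm, q, hq0, hq1, hmq⟩ := exists_midpoint (g a).norm_lt_one a.norm_lt_one
    (fun h => hne (Subtype.ext h))
  have h1 : r ⟨m, mem_ball_zero_iff.2 hm⟩ ≤ q * r a := by
    refine ciSup_le fun h => (hmq _ ((h : BallAut n) p).norm_lt_one).trans ?_
    gcongr
    exact max_le ((hle (g a) h).trans (hinv g hg a)) (hle a h)
  have h2 := hmin ⟨m, mem_ball_zero_iff.2 hm⟩
  nlinarith [hr1 a]

end Automorphisms

end BallMaps

namespace BallMaps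

open Metric Set Filter Topology

/-! ### From infinitely many linear symmetries to a linear vector field. -/

section Infinitesimal

variable {E F : Type*} [NormedAddCommGroup E] [InnerProductSpace ℂ E]
  [NormedAddCommGroup F] [InnerProductSpace ℂ F]

/-- A nonzero skew-adjoint operator has a unit eigenvector with nonzero eigenvalue. -/
theorem exists_eigenvector_of_skewAdjoint [FiniteDimensional ℂ E] {X : E →L[ℂ] E}
    -- The proof diagonalises the Hermitian operator `I • X`: if all its eigenvalues were zero, `X`
    -- would vanish.
    (hX : ∀ x y, inner ℂ (X x) y = -inner ℂ x (X y)) (hX0 : X ≠ 0) :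
    ∃ e : E, ‖e‖ = 1 ∧ ∃ l : ℂ, l ≠ 0 ∧ X e = l • e := by
  set T : E →ₗ[ℂ] E := Complex.I • (X : E →ₗ[ℂ] E) with hTdef
  have hTapp : ∀ x, T x = Complex.I • X x := fun x => rfl
  have hT : T.IsSymmetric := by
    intro x y
    rw [hTapp, hTapp, inner_smul_left, inner_smul_right, hX, Complex.conj_I]
    ring
  by_contra! hcon
  apply hX0
  have hb : ∀ i, X (hT.eigenvectorBasis rfl i) = 0 := by
    intro i
    have h1 := hT.apply_eigenvectorBasis rfl i
    rw [hTapp] at h1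
    have h2 : X (hT.eigenvectorBasis rfl i) =
        (-Complex.I * (hT.eigenvalues rfl i : ℂ)) • hT.eigenvectorBasis rfl i := by
      rw [mul_smul]
      erw [← h1]
      rw [smul_smul]
      simp
    by_cases hl : (-Complex.I * (hT.eigenvalues rfl i : ℂ)) = 0
    · rw [h2, hl, zero_smul]
    · exact absurd h2 (hcon _ ((hT.eigenvectorBasis rfl).orthonormal.1 i) _ hl)
  have h0 : (X : E →ₗ[ℂ] E) = 0 :=
    (hT.eigenvectorBasis rfl).toBasis.ext fun i => by simpa using hb i
  ext x
  exact LinearMap.congr_fun h0 x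

/-- Holomorphic solutions on the disc of `l t g' = W g` are polynomials. -/
theorem exists_eq_sum_of_deriv_eq [CompleteSpace F] {g : ℂ → F} {W : F →L[ℂ] F} {l : ℂ}
    (hl : l ≠ 0) (hg : DifferentiableOn ℂ g (ball 0 1))
    (h : ∀ t ∈ ball (0 : ℂ) 1, (l * t) • deriv g t = W (g t)) :
    ∃ (K : ℕ) (c : ℕ → F), ∀ t ∈ ball (0 : ℂ) 1, g t = ∑ k ∈ Finset.range K, t ^ k • c k := by
  have hd : ∀ k, DifferentiableOn ℂ (iteratedDeriv k g) (ball 0 1) := by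
    intro k
    induction k with
    | zero => rwa [iteratedDeriv_zero]
    | succ k ih =>
      rw [iteratedDeriv_succ]
      exact ih.deriv isOpen_ball
  -- The `k`-th derivative of the equation. At `t = 0` it makes `iteratedDeriv k g 0` an eigenvector
  -- of `W` for `l * k` unless it is zero, which is impossible once `|l| k > ‖W‖`.
  have hk : ∀ k : ℕ, ∀ t ∈ ball (0 : ℂ) 1,
      (l * t) • iteratedDeriv (k + 1) g t + (l * k) • iteratedDeriv k g t =
        W (iteratedDeriv k g t) := by
    intro k
    induction k with
    | zero => simpa [iteratedDeriv_succ] using h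
    | succ k ih =>
      intro t ht
      have hnt := isOpen_ball.mem_nhds ht
      have e0 := ((hd k).differentiableAt hnt).hasDerivAt
      have e1 := ((hd (k + 1)).differentiableAt hnt).hasDerivAt
      rw [← iteratedDeriv_succ] at e0 e1
      have e2 := (((hasDerivAt_id t).const_mul l).smul e1).add (e0.const_smul (l * (k : ℂ)))
      have e3 := W.hasFDerivAt.comp_hasDerivAt t e0
      have e4 := e2.unique (e3.congr_of_eventuallyEq (eventually_of_mem hnt ih))
      rw [← e4]
      simp only [id, mul_one]
      push_cast
      rw [mul_add, add_smul, mul_one]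
      abel
  obtain ⟨K, hK⟩ := exists_nat_gt (‖W‖ / ‖l‖)
  have hl' := norm_pos_iff.2 hl
  have hz : ∀ k, K ≤ k → iteratedDeriv k g 0 = 0 := by
    intro k hKk
    have h0 := hk k 0 (mem_ball_self one_pos)
    rw [mul_zero, zero_smul, zero_add] at h0
    have h1 := W.le_opNorm (iteratedDeriv k g 0)
    rw [← h0, norm_smul, norm_mul, Complex.norm_natCast] at h1
    by_contra hne
    have h2 := le_of_mul_le_mul_right h1 (norm_pos_iff.2 hne)
    rw [div_lt_iff₀ hl'] at hK
    have h3 : (K : ℝ) ≤ k := by exact_mod_cast hKk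
    nlinarith
  refine ⟨K, fun k => (k.factorial : ℂ)⁻¹ • iteratedDeriv k g 0, fun t ht => ?_⟩
  have hs := Complex.hasSum_taylorSeries_on_ball hg ht
  have hs' := hasSum_sum_of_ne_finset_zero (L := SummationFilter.unconditional ℕ)
    (s := Finset.range K)
    (f := fun k : ℕ => (k.factorial : ℂ)⁻¹ • (t - 0) ^ k • iteratedDeriv k g 0)
    (fun k hk' => by rw [hz k (by simpa using hk'), smul_zero, smul_zero])
  rw [hs.unique hs']
  refine Finset.sum_congr rfl fun k _ => ?_
  rw [sub_zero, smul_comm]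

/-- Near an accumulation point, choose `x`, then `y` strictly closer to that point, which makes them
distinct. -/
theorem exists_dist_lt_of_infinite {α : Type*} [MetricSpace α] {S C : Set α}
    (hS : S.Infinite) (hC : IsCompact C) (hSC : S ⊆ C) {ε : ℝ} (hε : 0 < ε) :
    ∃ x ∈ S, ∃ y ∈ S, x ≠ y ∧ dist x y < ε := by
  obtain ⟨p, -, hp⟩ := hS.exists_accPt_of_subset_isCompact hC hSC
  rw [accPt_iff_nhds] at hp
  obtain ⟨x, ⟨hx, hxS⟩, hxp⟩ := hp _ (ball_mem_nhds p (half_pos hε))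
  obtain ⟨y, ⟨hy, hyS⟩, hyp⟩ := hp _ (ball_mem_nhds p (dist_pos.2 hxp))
  rw [mem_ball] at hx hy
  refine ⟨x, hxS, y, hyS, fun h => ?_, ?_⟩
  · rw [h] at hy
    exact lt_irrefl _ hy
  · have := dist_triangle_right x y p
    linarith

/-- The pair of continuous linear maps underlying a pair of linear isometries. -/
def toCLMPair (p : (E →ₗᵢ[ℂ] E) × (F →ₗᵢ[ℂ] F)) : (E →L[ℂ] E) × (F →L[ℂ] F) :=
  (p.1.toContinuousLinearMap, p.2.toContinuousLinearMap)

theorem toCLMPair_injective : Function.Injective (toCLMPair (E := E) (F := F)) := by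
  intro p q h
  obtain ⟨h1, h2⟩ := Prod.ext_iff.1 h
  exact Prod.ext (LinearIsometry.ext fun x => DFunLike.congr_fun h1 x)
    (LinearIsometry.ext fun x => DFunLike.congr_fun h2 x)

theorem norm_toCLMPair_le (p : (E →ₗᵢ[ℂ] E) × (F →ₗᵢ[ℂ] F)) : ‖toCLMPair p‖ ≤ 1 :=
  norm_prod_le_iff.2 ⟨p.1.norm_toContinuousLinearMap_le, p.2.norm_toContinuousLinearMap_le⟩

/-- An infinite set of pairs of linear isometries that is closed under left division has elements
arbitrarily close to the identity. -/
theorem exists_norm_lt_of_infinite [FiniteDimensional ℂ E] [FiniteDimensional ℂ F]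
    {S : Set ((E →ₗᵢ[ℂ] E) × (F →ₗᵢ[ℂ] F))} (hS : S.Infinite)
    (hdiv : ∀ p ∈ S, ∀ q ∈ S, ∃ r ∈ S, p.1.comp r.1 = q.1 ∧ p.2.comp r.2 = q.2)
    {ε : ℝ} (hε : 0 < ε) :
    ∃ p ∈ S, toCLMPair p - 1 ≠ 0 ∧ ‖toCLMPair p - 1‖ < ε := by
  have : ProperSpace ((E →L[ℂ] E) × (F →L[ℂ] F)) := FiniteDimensional.proper ℂ _
  obtain ⟨_, ⟨p, hp, rfl⟩, _, ⟨q, hq, rfl⟩, hne, hlt⟩ := exists_dist_lt_of_infinite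
    (hS.image toCLMPair_injective.injOn) (isCompact_closedBall 0 1)
    (image_subset_iff.2 fun p _ => mem_closedBall_zero_iff.2 (norm_toCLMPair_le p)) hε
  -- `r` is `p⁻¹ q`, and `‖r - 1‖ ≤ ‖q - p‖` because the components of `p` preserve norms.
  obtain ⟨r, hr, h1, h2⟩ := hdiv p hp q hq
  have hq1 : ∀ x, q.1 x = p.1 (r.1 x) := fun x => by rw [← h1]; rfl
  have hq2 : ∀ x, q.2 x = p.2 (r.2 x) := fun x => by rw [← h2]; rfl
  refine ⟨r, hr, fun h0 => hne ?_, lt_of_le_of_lt ?_ hlt⟩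
  · obtain ⟨h3, h4⟩ := Prod.ext_iff.1 (sub_eq_zero.1 h0)
    have h3' : ∀ x, r.1 x = x := fun x => DFunLike.congr_fun h3 x
    have h4' : ∀ x, r.2 x = x := fun x => DFunLike.congr_fun h4 x
    congr 1
    exact Prod.ext (LinearIsometry.ext fun x => by rw [hq1, h3'])
      (LinearIsometry.ext fun x => by rw [hq2, h4'])
  · rw [dist_comm, dist_eq_norm]
    refine norm_prod_le_iff.2 ⟨ContinuousLinearMap.opNorm_le_bound _ (norm_nonneg _) fun x => ?_,
      ContinuousLinearMap.opNorm_le_bound _ (norm_nonneg _) fun x => ?_⟩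
    · calc ‖r.1 x - x‖ = ‖(toCLMPair q - toCLMPair p).1 x‖ := by
            rw [← p.1.norm_map, map_sub, ← hq1]; rfl
        _ ≤ _ := (ContinuousLinearMap.le_opNorm _ _).trans
            (mul_le_mul_of_nonneg_right (norm_fst_le _) (norm_nonneg _))
    · calc ‖r.2 x - x‖ = ‖(toCLMPair q - toCLMPair p).2 x‖ := by
            rw [← p.2.norm_map, map_sub, ← hq2]; rfl
        _ ≤ _ := (ContinuousLinearMap.le_opNorm _ _).trans
            (mul_le_mul_of_nonneg_right (norm_snd_le _) (norm_nonneg _))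

/-- A holomorphic map that is equivariant under infinitely many pairs of linear isometries is
equivariant under a nonzero pair of linear vector fields. -/
theorem exists_infinitesimal_symmetry [FiniteDimensional ℂ E] [FiniteDimensional ℂ F]
    {S : Set ((E →ₗᵢ[ℂ] E) × (F →ₗᵢ[ℂ] F))} (hS : S.Infinite)
    (hdiv : ∀ p ∈ S, ∀ q ∈ S, ∃ r ∈ S, p.1.comp r.1 = q.1 ∧ p.2.comp r.2 = q.2)
    {φ : E → F} (hφ : DifferentiableOn ℂ φ (ball 0 1))
    (heq : ∀ p ∈ S, ∀ z ∈ ball (0 : E) 1, φ (p.1 z) = p.2 (φ z)) :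
    ∃ (X : E →L[ℂ] E) (W : F →L[ℂ] F), (X, W) ≠ 0 ∧
      (∀ x y, inner ℂ (X x) y = -inner ℂ x (X y)) ∧
      ∀ z ∈ ball (0 : E) 1, fderiv ℂ φ z (X z) = W (φ z) := by
  have : ProperSpace ((E →L[ℂ] E) × (F →L[ℂ] F)) := FiniteDimensional.proper ℂ _
  have hex : ∀ k : ℕ, ∃ p ∈ S, toCLMPair p - 1 ≠ 0 ∧ ‖toCLMPair p - 1‖ < 1 / ((k : ℝ) + 1) :=
    fun k => exists_norm_lt_of_infinite hS hdiv (by positivity)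
  choose p hpS hp0 hpk using hex
  let Q : ℕ → (E →L[ℂ] E) × (F →L[ℂ] F) := fun k => toCLMPair (p k) - 1
  have hQ0 : Tendsto Q atTop (𝓝 0) :=
    squeeze_zero_norm (fun k => (hpk k).le) tendsto_one_div_add_atTop_nhds_zero_nat
  let c : ℕ → ℂ := fun k => ((‖Q k‖⁻¹ : ℝ) : ℂ)
  have hcn : ∀ k, ‖c k‖ = ‖Q k‖⁻¹ := fun k => by
    rw [Complex.norm_real, norm_inv, norm_norm]
  have hcQ : ∀ k, c k • Q k ∈ sphere (0 : (E →L[ℂ] E) × (F →L[ℂ] F)) 1 := by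
    intro k
    rw [mem_sphere_zero_iff_norm, norm_smul, hcn, inv_mul_cancel₀ (norm_ne_zero_iff.2 (hp0 k))]
  -- The differences `p k - 1`, scaled to norm one, subconverge by compactness of the sphere; the
  -- limit still has norm one, so it is not zero.
  obtain ⟨⟨X, W⟩, hXW, s, hs, hlim⟩ := (isCompact_sphere _ _).tendsto_subseq hcQ
  have hX : ∀ x, Tendsto (fun k => c (s k) • (Q (s k)).1 x) atTop (𝓝 (X x)) := fun x =>
    (((ContinuousLinearMap.apply ℂ E x).continuous.comp continuous_fst).tendsto _).comp hlim
  have hW : ∀ x, Tendsto (fun k => c (s k) • (Q (s k)).2 x) atTop (𝓝 (W x)) := fun x =>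
    (((ContinuousLinearMap.apply ℂ F x).continuous.comp continuous_snd).tendsto _).comp hlim
  have hQX : ∀ x, Tendsto (fun k => (Q (s k)).1 x) atTop (𝓝 0) := fun x =>
    (((ContinuousLinearMap.apply ℂ E x).continuous.comp continuous_fst).tendsto _).comp
      (hQ0.comp hs.tendsto_atTop)
  have hp1 : ∀ k x, (p k).1 x = x + (Q k).1 x := fun k x => (add_sub_cancel x ((p k).1 x)).symm
  have hp2 : ∀ k x, (p k).2 x = x + (Q k).2 x := fun k x => (add_sub_cancel x ((p k).2 x)).symm
  refine ⟨X, W, ?_, ?_, ?_⟩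
  · rintro h0
    rw [h0] at hXW
    simp at hXW
  · intro x y
    -- Expansion of `⟪p x, p y⟫ = ⟪x, y⟫`; after scaling, the quadratic term still carries a factor
    -- tending to 0.
    have h1 : ∀ k, inner ℂ (c k • (Q k).1 x) y + inner ℂ x (c k • (Q k).1 y) +
        inner ℂ (c k • (Q k).1 x) ((Q k).1 y) = 0 := by
      intro k
      have h2 := (p k).1.inner_map_map x y
      rw [hp1, hp1, inner_add_left, inner_add_right, inner_add_right] at h2
      rw [inner_smul_left, inner_smul_left, inner_smul_right, Complex.conj_ofReal]
      linear_combination c k * h2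
    have h3 := (((hX x).inner (𝕜 := ℂ) (tendsto_const_nhds (x := y))).add
      ((tendsto_const_nhds (x := x)).inner (𝕜 := ℂ) (hX y))).add ((hX x).inner (𝕜 := ℂ) (hQX y))
    simp only [h1, inner_zero_right, add_zero] at h3
    exact eq_neg_of_add_eq_zero_left (tendsto_nhds_unique h3 tendsto_const_nhds)
  · intro z hz
    have h1 := (hφ.differentiableAt (isOpen_ball.mem_nhds hz)).hasFDerivAt.hasFDerivWithinAt
      (s := univ)
    have h2 := h1.lim (d := fun k => (Q (s k)).1 z) (hQX z) (by simp) (hX z)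
    refine tendsto_nhds_unique h2 ((hW (φ z)).congr fun k => ?_)
    rw [← hp1, heq _ (hpS _) z hz, hp2, add_sub_cancel_left]

end Infinitesimal

end BallMaps

namespace BallMaps

open Metric Set Filter Topology

/-! ### Rationality on a line after Möbius changes of coordinates. -/

section Rationality

variable {n N : ℕ}

/-- Functions on `ℂⁿ` given by a polynomial in the coordinates. -/
def IsPolynomialFun (h : CSpace n → ℂ) : Prop :=
  ∃ p : MvPolynomial (Fin n) ℂ, ∀ z : CSpace n, MvPolynomial.eval (fun i => z i) p = h z

namespace IsPolynomialFun

theorem const (c : ℂ) : IsPolynomialFun fun _ : CSpace n => c :=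
  ⟨MvPolynomial.C c, fun z => by simp⟩

theorem sub {g h : CSpace n → ℂ} (hg : IsPolynomialFun g) (hh : IsPolynomialFun h) :
    IsPolynomialFun fun z => g z - h z := by
  obtain ⟨p, hp⟩ := hg
  obtain ⟨q, hq⟩ := hh
  exact ⟨p - q, fun z => by rw [map_sub, hp, hq]⟩

theorem mul {g h : CSpace n → ℂ} (hg : IsPolynomialFun g) (hh : IsPolynomialFun h) :
    IsPolynomialFun fun z => g z * h z := by
  obtain ⟨p, hp⟩ := hg
  obtain ⟨q, hq⟩ := hh
  exact ⟨p * q, fun z => by rw [map_mul, hp, hq]⟩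

theorem pow {g : CSpace n → ℂ} (hg : IsPolynomialFun g) (k : ℕ) :
    IsPolynomialFun fun z => g z ^ k := by
  obtain ⟨p, hp⟩ := hg
  exact ⟨p ^ k, fun z => by rw [map_pow, hp]⟩

theorem sum {ι : Type*} (s : Finset ι) {g : ι → CSpace n → ℂ}
    (hg : ∀ i, IsPolynomialFun (g i)) : IsPolynomialFun fun z => ∑ i ∈ s, g i z := by
  choose p hp using hg
  exact ⟨∑ i ∈ s, p i, fun z => by rw [map_sum]; exact Finset.sum_congr rfl fun i _ => hp i z⟩

theorem inner_right (w : CSpace n) : IsPolynomialFun fun z => inner ℂ w z := by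
  refine ⟨∑ i, MvPolynomial.C ((starRingEnd ℂ) (w i)) * MvPolynomial.X i, fun z => ?_⟩
  simp [PiLp.inner_apply, mul_comm]

end IsPolynomialFun

/-- If `f` becomes polynomial on a line through the centre after Möbius changes of coordinates
that move `a` and `b` to the centre, then `f` is rational on a line through `a`. -/
theorem isRationalOn_of_moebius_eq_sum {f : UnitBall n → UnitBall N} {a : UnitBall n}
    {b : UnitBall N} {e : CSpace n} (he : ‖e‖ = 1) {K : ℕ} {c : ℕ → CSpace N}
    (h : ∀ (z : UnitBall n) (t : ℂ), (ballMoebius a z : CSpace n) = t • e →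
      moebius (b : CSpace N) (f z) = ∑ k ∈ Finset.range K, t ^ k • c k) :
    IsRationalOn f (AffineSubspace.mk' (a : CSpace n)
      (Submodule.span ℂ {moebiusLin (a : CSpace n) e - inner ℂ (a : CSpace n) e • (a : CSpace n)})) := by
  have ha := a.norm_lt_one
  have hb := b.norm_lt_one
  set V := AffineSubspace.mk' (a : CSpace n)
    (Submodule.span ℂ {moebiusLin (a : CSpace n) e - inner ℂ (a : CSpace n) e • (a : CSpace n)})
  -- On `V` the involution at `a` sends `z` to `(M z / D z) • e`. Multiplying by `D ^ K` clears the
  -- denominators in `∑ t ^ k • c k`; as `k < K`, the exponent `K - k` is not truncated.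
  let D : CSpace n → ℂ := fun z => 1 - inner ℂ (a : CSpace n) z
  let M : CSpace n → ℂ := fun z => inner ℂ e (a : CSpace n) - inner ℂ (moebiusLin (a : CSpace n) e) z
  have hD : IsPolynomialFun D := (IsPolynomialFun.const 1).sub (.inner_right _)
  have hM : IsPolynomialFun M := (IsPolynomialFun.const _).sub (.inner_right _)
  let G : CSpace n → CSpace N := fun z => ∑ k ∈ Finset.range K, (M z ^ k * D z ^ (K - k)) • c k
  have hG : ∀ Λ : CSpace N →L[ℂ] ℂ, IsPolynomialFun fun z => Λ (G z) := by
    intro Λ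
    have : (fun z => Λ (G z)) =
        fun z => ∑ k ∈ Finset.range K, M z ^ k * D z ^ (K - k) * Λ (c k) := by
      funext z
      simp only [G, map_sum, map_smul, smul_eq_mul]
    rw [this]
    exact .sum _ fun k => ((hM.pow k).mul (hD.pow _)).mul (.const _)
  obtain ⟨q, hq⟩ := (hD.pow K).sub (hG (innerSL ℂ (b : CSpace N)))
  have hp : ∀ j : Fin N, IsPolynomialFun fun z =>
      D z ^ K * (b : CSpace N) j - (moebiusLin (b : CSpace N) (G z)) j := fun j =>
    ((hD.pow K).mul (.const _)).sub
      (hG ((EuclideanSpace.proj j : CSpace N →L[ℂ] ℂ).comp (moebiusLin (b : CSpace N))))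
  choose p hp using hp
  have hline : ∀ z : UnitBall n, (z : CSpace n) ∈ V → ∃ g : CSpace N, ‖g‖ < 1 ∧
      moebius (b : CSpace N) g = f z ∧ G z = D z ^ K • g := by
    intro z hz
    have hDz : D z ≠ 0 := one_sub_inner_ne_zero ha z.norm_lt_one
    rw [AffineSubspace.mem_mk', vsub_eq_sub, Submodule.mem_span_singleton] at hz
    obtain ⟨τ, hτ⟩ := hz
    have h1 : (ballMoebius a z : CSpace n) =
        ((D z)⁻¹ * -(τ * (moebiusScale (a : CSpace n) : ℂ) ^ 2)) • e := by
      -- `moebiusLin a` sends the direction vector of `V` to `s ^ 2 • e`, which is why `V` has that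
      -- direction.
      have h2 : (a : CSpace n) - moebiusLin (a : CSpace n) z =
          -(τ * (moebiusScale (a : CSpace n) : ℂ) ^ 2) • e := by
        have h3 : (z : CSpace n) = a + τ • (moebiusLin (a : CSpace n) e -
            inner ℂ (a : CSpace n) e • (a : CSpace n)) := by rw [hτ]; abel
        rw [h3, map_add, map_smul, map_sub, map_smul, moebiusLin_self ha, moebiusLin_moebiusLin ha,
          add_sub_cancel_right, smul_smul, neg_smul]
        abel
      rw [coe_ballMoebius, moebius, h2, smul_smul]
    have h4 : (ballMoebius a z : CSpace n) = (M z / D z) • e := by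
      have h5 : inner ℂ e (ballMoebius a z : CSpace n) = M z / D z := by
        rw [coe_ballMoebius, moebius, inner_smul_right, inner_sub_right, ← inner_moebiusLin_left,
          div_eq_inv_mul]
      have h6 : inner ℂ e (ballMoebius a z : CSpace n) =
          (D z)⁻¹ * -(τ * (moebiusScale (a : CSpace n) : ℂ) ^ 2) := by
        rw [h1, inner_smul_right, inner_self_eq_norm_sq_to_K, he]
        simp
      rw [← h5, h6, ← h1]
    refine ⟨moebius (b : CSpace N) (f z), norm_moebius_lt_one hb (f z).norm_lt_one,
      moebius_moebius hb (f z).norm_lt_one, ?_⟩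
    rw [h z _ h4, Finset.smul_sum]
    refine Finset.sum_congr rfl fun k hk => ?_
    rw [smul_smul, div_pow, ← Nat.sub_add_cancel (Finset.mem_range.1 hk).le, pow_add,
      Nat.add_sub_cancel]
    congr 1
    field_simp
  have hqg : ∀ (z : CSpace n) (g : CSpace N), G z = D z ^ K • g →
      MvPolynomial.eval (fun i => z i) q = D z ^ K * (1 - inner ℂ (b : CSpace N) g) := by
    intro z g hg
    rw [hq]
    simp only [hg, innerSL_apply_apply, inner_smul_right]
    ring
  refine ⟨p, q, ⟨a, AffineSubspace.self_mem_mk' _ _, ?_⟩, fun z hz j => ?_⟩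
  · obtain ⟨g, hg, -, hgG⟩ := hline a (AffineSubspace.self_mem_mk' _ _)
    rw [hqg _ g hgG]
    exact mul_ne_zero (pow_ne_zero _ (one_sub_inner_ne_zero ha ha)) (one_sub_inner_ne_zero hb hg)
  · obtain ⟨g, hg, hgf, hgG⟩ := hline z hz
    have := one_sub_inner_ne_zero hb hg
    rw [hqg _ g hgG, hp, ← hgf, moebius]
    simp only [hgG, map_smul, PiLp.smul_apply, PiLp.sub_apply, smul_eq_mul]
    field_simp

end Rationality

/-! ### Finiteness of the symmetry group. -/

section Symmetries

variable {n N : ℕ} {f : UnitBall n → UnitBall N}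

/-- If `Γ_f` and `T_f` have fixed points, then there are only finitely many symmetries. -/
theorem finite_equivariancePairs (hf : IsHolomorphic f) (hmin : IsMinimal f)
    (hrat : IsCompletelyNonRational f) {a : UnitBall n} {b : UnitBall N}
    (ha : ∀ γ ∈ sourceGroup f, γ a = a) (hb : ∀ ψ ∈ targetGroup f, ψ b = b) :
    (equivariancePairs f : Set (BallAut n × BallAut N)).Finite := by
  by_contra hinf
  obtain ⟨φ, hφ, hφf⟩ :=
    (isHolomorphic_ballMoebius b).comp (hf.comp (isHolomorphic_ballMoebius a))
  have hφ' : ∀ z : UnitBall n, φ z = ballMoebius b (f (ballMoebius a z)) := hφf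
  -- All linear equivariant pairs, not only those coming from `A_f`; closure under division then
  -- needs only that isometries are invertible in finite dimension.
  let S : Set ((CSpace n →ₗᵢ[ℂ] CSpace n) × (CSpace N →ₗᵢ[ℂ] CSpace N)) :=
    {p | ∀ z ∈ ball (0 : CSpace n) 1, φ (p.1 z) = p.2 (φ z)}
  have hconj : ∀ x : equivariancePairs f,
      ∃ p : (CSpace n →ₗᵢ[ℂ] CSpace n) × (CSpace N →ₗᵢ[ℂ] CSpace N),
        (∀ z, (ballMoebius a (x.1.1 (ballMoebius a z)) : CSpace n) = p.1 z) ∧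
        ∀ z, (ballMoebius b (x.1.2 (ballMoebius b z)) : CSpace N) = p.2 z := by
    rintro ⟨x, hx⟩
    obtain ⟨U, hU⟩ := BallAut.exists_linearIsometry
      (γ := moebiusAut a * x.1 * moebiusAut a) (by
        change ballMoebius a (x.1 (ballMoebius a (centre n))) = centre n
        rw [ballMoebius_centre]
        exact (congrArg (ballMoebius a) (ha _ ⟨x, hx, rfl⟩)).trans (ballMoebius_self a))
    obtain ⟨V, hV⟩ := BallAut.exists_linearIsometry
      (γ := moebiusAut b * x.2 * moebiusAut b) (by
        change ballMoebius b (x.2 (ballMoebius b (centre N))) = centre N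
        rw [ballMoebius_centre]
        exact (congrArg (ballMoebius b) (hb _ ⟨x, hx, rfl⟩)).trans (ballMoebius_self b))
    exact ⟨(U, V), hU, hV⟩
  choose P hP₁ hP₂ using hconj
  have hPinj : Function.Injective P := by
    intro x y hxy
    refine Subtype.ext (Prod.ext (BallAut.ext fun z => ?_) (BallAut.ext fun z => ?_))
    · have h : ballMoebius a (x.1.1 z) = ballMoebius a (y.1.1 z) := by
        have h1 := hP₁ x (ballMoebius a z)
        have h2 := hP₁ y (ballMoebius a z)
        rw [ballMoebius_ballMoebius] at h1 h2
        exact Subtype.ext (by rw [h1, h2, hxy])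
      rw [← ballMoebius_ballMoebius a (x.1.1 z), h, ballMoebius_ballMoebius]
    · have h : ballMoebius b (x.1.2 z) = ballMoebius b (y.1.2 z) := by
        have h1 := hP₂ x (ballMoebius b z)
        have h2 := hP₂ y (ballMoebius b z)
        rw [ballMoebius_ballMoebius] at h1 h2
        exact Subtype.ext (by rw [h1, h2, hxy])
      rw [← ballMoebius_ballMoebius b (x.1.2 z), h, ballMoebius_ballMoebius]
  have hPS : ∀ x, P x ∈ S := by
    intro x z hz
    lift z to UnitBall n using hz
    rw [← hP₁, hφ', hφ', ← hP₂, ballMoebius_ballMoebius, ballMoebius_ballMoebius]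
    have : f (x.1.1 (ballMoebius a z)) = x.1.2 (f (ballMoebius a z)) := congrFun x.2 _
    rw [this]
  have hSinf : S.Infinite := by
    have : Infinite (equivariancePairs f) := Set.infinite_coe_iff.2 hinf
    exact Set.infinite_of_injective_forall_mem hPinj hPS
  have hdiv : ∀ p ∈ S, ∀ q ∈ S, ∃ r ∈ S, p.1.comp r.1 = q.1 ∧ p.2.comp r.2 = q.2 := by
    intro p hp q hq
    let u := p.1.toLinearIsometryEquiv rfl
    let v := p.2.toLinearIsometryEquiv rfl
    have hu : ∀ x, p.1 (u.symm x) = x := u.apply_symm_apply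
    have hv : ∀ x, p.2 (v.symm x) = x := v.apply_symm_apply
    refine ⟨(u.symm.toLinearIsometry.comp q.1, v.symm.toLinearIsometry.comp q.2), fun z hz => ?_,
      LinearIsometry.ext fun x => hu _, LinearIsometry.ext fun x => hv _⟩
    apply p.2.injective
    have hz' : u.symm (q.1 z) ∈ ball (0 : CSpace n) 1 := by
      simpa [LinearIsometryEquiv.norm_map, LinearIsometry.norm_map] using hz
    have h := hp _ hz'
    rw [hu, hq z hz] at h
    exact h.symm.trans (hv _).symm
  obtain ⟨X, W, hXW, hskew, hode⟩ := exists_infinitesimal_symmetry hSinf hdiv hφ fun p hp => hp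
  by_cases hX : X = 0
  · have hW : ∀ z : UnitBall n, W (b - moebiusLin (b : CSpace N) (f z)) = 0 := by
      intro z
      have h := hode _ (ballMoebius a z).2
      rw [hX, zero_apply, map_zero, hφ', ballMoebius_ballMoebius,
        coe_ballMoebius, moebius, map_smul] at h
      exact (smul_eq_zero.1 h.symm).resolve_left
        (inv_ne_zero (one_sub_inner_ne_zero b.norm_lt_one (f z).norm_lt_one))
    -- `W` vanishes on the image of `φ`, so `f` maps into the affine subspace `b + ker (W ∘
    -- moebiusLin b)`. By minimality this is everything, and `W = 0` since `moebiusLin b` is onto.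
    have htop := hmin (AffineSubspace.mk' (b : CSpace N)
      (LinearMap.ker (W.comp (moebiusLin (b : CSpace N))).toLinearMap)) (by
        intro z
        rw [AffineSubspace.mem_mk', vsub_eq_sub, LinearMap.mem_ker]
        change W (moebiusLin (b : CSpace N) (f z - b)) = 0
        rw [map_sub, moebiusLin_self b.norm_lt_one, ← neg_sub, map_neg, hW z, neg_zero])
    have hker := congrArg AffineSubspace.direction htop
    rw [AffineSubspace.direction_mk', AffineSubspace.direction_top, LinearMap.ker_eq_top] at hker
    apply hXW
    refine Prod.ext hX (ContinuousLinearMap.ext fun y => ?_)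
    obtain ⟨x, rfl⟩ := moebiusLin_surjective b.norm_lt_one y
    exact LinearMap.congr_fun hker x
  · obtain ⟨e, he, l, hl, hXe⟩ := exists_eigenvector_of_skewAdjoint hskew hX
    have hmap : MapsTo (fun t : ℂ => t • e) (ball 0 1) (ball 0 1) := by
      intro t ht
      simpa [norm_smul, he] using ht
    obtain ⟨K, c, hKc⟩ := exists_eq_sum_of_deriv_eq (g := fun t => φ (t • e)) (W := W) hl
      (hφ.comp (differentiable_id.smul_const e).differentiableOn hmap) (by
        intro t ht
        have h1 := (hφ.differentiableAt (isOpen_ball.mem_nhds (hmap ht))).hasFDerivAt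
        have h2 : HasDerivAt (fun t : ℂ => t • e) e t := by
          simpa using (hasDerivAt_id t).smul_const e
        have h3 : deriv (fun t => φ (t • e)) t = fderiv ℂ φ (t • e) e :=
          (h1.comp_hasDerivAt t h2).deriv
        rw [h3, ← hode _ (hmap ht), map_smul, hXe, smul_smul,
          map_smul, mul_comm])
    -- The direction vector is nonzero because `moebiusLin a` maps it to `s ^ 2 • e`.
    have hv : moebiusLin (a : CSpace n) e - inner ℂ (a : CSpace n) e • (a : CSpace n) ≠ 0 := by
      intro h0
      have h1 := congrArg (moebiusLin (a : CSpace n)) h0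
      rw [map_sub, map_smul, moebiusLin_moebiusLin a.norm_lt_one, moebiusLin_self a.norm_lt_one,
        add_sub_cancel_right, map_zero] at h1
      refine smul_ne_zero (pow_ne_zero 2 (moebiusScale_ne_zero a.norm_lt_one)) ?_ h1
      exact norm_ne_zero_iff.1 (by rw [he]; exact one_ne_zero)
    refine hrat _ ?_ ⟨a, AffineSubspace.self_mem_mk' _ _⟩
      (isRationalOn_of_moebius_eq_sum (b := b) (K := K) (c := c) he fun z t hzt => ?_)
    · rw [AffineSubspace.direction_mk', finrank_span_singleton hv]
      exact one_pos
    · have ht : t ∈ ball (0 : ℂ) 1 := by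
        have := (ballMoebius a z).norm_lt_one
        rw [hzt, norm_smul, he, mul_one] at this
        exact mem_ball_zero_iff.2 this
      rw [← hKc t ht]
      change _ = φ (t • e)
      rw [← hzt, hφ', ballMoebius_ballMoebius, coe_ballMoebius]

theorem continuous_apply_const (z : UnitBall n) : Continuous fun γ : BallAut n => γ z := by
  have h : Continuous (BallAut.toContinuousMap (n := n)) := continuous_induced_dom
  exact (continuous_eval_const (F := C(UnitBall n, UnitBall n)) z).comp h

theorem exists_norm_le_of_isCompact {C : Set (UnitBall n)} (hC : IsCompact C) :
    ∃ ρ < 1, ∀ z ∈ C, ‖(z : CSpace n)‖ ≤ ρ := by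
  rcases C.eq_empty_or_nonempty with rfl | hne
  · exact ⟨0, one_pos, by simp⟩
  · obtain ⟨w, -, hw⟩ := hC.exists_isMaxOn hne
      (f := fun z : UnitBall n => ‖(z : CSpace n)‖) (by fun_prop)
    exact ⟨_, w.norm_lt_one, fun z hz => hw hz⟩

/-- If an orbit of `Γ_f` and the orbit of its image under `T_f` are relatively compact, then there
are only finitely many symmetries. -/
theorem finite_equivariancePairs_of_isCompact (hf : IsHolomorphic f) (hmin : IsMinimal f)
    (hrat : IsCompletelyNonRational f) {z : UnitBall n} {C : Set (UnitBall n)}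
    {C' : Set (UnitBall N)} (hC : IsCompact C) (hC' : IsCompact C')
    (h : ∀ γ ∈ sourceGroup f, γ z ∈ C) (h' : ∀ ψ ∈ targetGroup f, ψ (f z) ∈ C') :
    (equivariancePairs f : Set (BallAut n × BallAut N)).Finite := by
  obtain ⟨ρ, hρ, hCρ⟩ := exists_norm_le_of_isCompact hC
  obtain ⟨ρ', hρ', hCρ'⟩ := exists_norm_le_of_isCompact hC'
  obtain ⟨a, ha⟩ := exists_fixedPoint (sourceGroup f) z hρ fun γ hγ => hCρ _ (h γ hγ)
  obtain ⟨b, hb⟩ := exists_fixedPoint (targetGroup f) (f z) hρ' fun ψ hψ => hCρ' _ (h' ψ hψ)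
  exact finite_equivariancePairs hf hmin hrat ha hb

end Symmetries

end BallMaps

theorem theorem5p1 (n N : ℕ) (f : BallMaps.UnitBall n → BallMaps.UnitBall N)
    (hf : BallMaps.IsHolomorphic f) (hproper : IsProperMap f)
    (hmin : BallMaps.IsMinimal f) (hrat : BallMaps.IsCompletelyNonRational f) :
    ((BallMaps.sourceGroup f : Set (BallMaps.BallAut n)).Finite ∧
      (BallMaps.targetGroup f : Set (BallMaps.BallAut N)).Finite) ∨
    (¬ IsCompact (BallMaps.sourceGroup f : Set (BallMaps.BallAut n)) ∧
      ¬ IsCompact (BallMaps.targetGroup f : Set (BallMaps.BallAut N))) := by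
  by_cases hfin : (BallMaps.equivariancePairs f : Set (BallMaps.BallAut n × BallMaps.BallAut N)).Finite
  · exact Or.inl ⟨hfin.image Prod.fst, hfin.image Prod.snd⟩
  refine Or.inr ⟨fun hc => hfin ?_, fun hc => hfin ?_⟩
  · have hC := hc.image (BallMaps.continuous_apply_const (BallMaps.centre n))
    refine BallMaps.finite_equivariancePairs_of_isCompact hf hmin hrat hC
      (hC.image hproper.continuous) (fun γ hγ => ⟨γ, hγ, rfl⟩) ?_
    rintro _ ⟨x, hx, rfl⟩
    exact ⟨_, ⟨x.1, ⟨x, hx, rfl⟩, rfl⟩, congrFun hx _⟩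
  · have hC := hc.image (BallMaps.continuous_apply_const (f (BallMaps.centre n)))
    refine BallMaps.finite_equivariancePairs_of_isCompact hf hmin hrat
      -- Properness enters here: the `Γ_f`-orbit of 0 lies in the preimage of the compact
      -- `T_f`-orbit of `f 0`.
      (hproper.isCompact_preimage hC) hC ?_ fun ψ hψ => ⟨ψ, hψ, rfl⟩
    rintro _ ⟨x, hx, rfl⟩
    exact ⟨x.2, ⟨x, hx, rfl⟩, (congrFun hx _).symm⟩
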